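/- Let $\mathcal H$ be an infinite-dimensional separable complex Hilbert space, let $\mathcal K(\mathcal H)$ be the space of compact operators on $\mathcal H$ with the operator norm, and let $\Psi:\mathcal K(\mathcal H)\to\mathcal B(\mathcal H\otimes\mathcal H)$ be a linear map that is continuous with respect to the operator norms, where $\mathcal H\otimes\mathcal H$ is the Hilbert space tensor product. Let $S\in\mathcal B(\mathcal H\otimes\mathcal H)$ be the swap operator, $S(x\otimes y)=y\otimes x$, and for a unit vector $e$ let $ee^*$ be the rank-one projection $z\mapsto\langle z,e\rangle e$. Then the following statements are equivalent: (a) $\Psi$ is covariant under unitary evolution: $\Psi(UXU^*)=(U\otimes U)\Psi(X)(U^*\otimes U^*)$ for all $X\in\mathcal K(\mathcal H)$ and all unitary operators $U$ on $\mathcal H$; (b) there is a unit vector $e\in\mathcal H$ such that $\Psi(Uee^*U^*)=(U\otimes U)\Psi(ee^*)(U^*\otimes U^*)$ for all unitary operators $U$ on $\mathcal H$; (c) there exist complex numbers $\lambda_1,\lambda_2,\lambda_3,\lambda_4$ such that $$\Psi(X)=\lambda_1\, I\otimes X+\lambda_2\, X\otimes I+\lambda_3\, S(I\otimes X)+\lambda_4\,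 S(X\otimes I)\qquad\text{for all }X\in\mathcal K(\mathcal H).$$ -/

import Mathlib

open scoped TensorProduct

noncomputable section

namespace UnitaryCovariance

variable (H : Type*) [NormedAddCommGroup H] [InnerProductSpace ℂ H]

/-- The Hilbert space tensor product `H ⊗ H`: the completion of the algebraic tensor product for
the inner product `⟪a ⊗ b, c ⊗ d⟫ = ⟪a, c⟫ * ⟪b, d⟫`. -/
def HilbertTensor : Type _ := UniformSpace.Completion (H ⊗[ℂ] H)

instance : NormedAddCommGroup (HilbertTensor H) :=
  inferInstanceAs (NormedAddCommGroup (UniformSpace.Completion (H ⊗[ℂ] H)))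

instance : InnerProductSpace ℂ (HilbertTensor H) :=
  inferInstanceAs (InnerProductSpace ℂ (UniformSpace.Completion (H ⊗[ℂ] H)))

instance : CompleteSpace (HilbertTensor H) :=
  inferInstanceAs (CompleteSpace (UniformSpace.Completion (H ⊗[ℂ] H)))

variable {H} in
/-- The canonical isometric embedding of the algebraic tensor product into `H ⊗ H`. -/
def ofAlg : H ⊗[ℂ] H →ₗᵢ[ℂ] HilbertTensor H :=
  (UniformSpace.Completion.toComplₗᵢ : H ⊗[ℂ] H →ₗᵢ[ℂ] UniformSpace.Completion (H ⊗[ℂ] H))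

/-- `K(H)`: the space of compact operators on `H`, with the operator norm. -/
abbrev Compacts : Submodule ℂ (H →L[ℂ] H) := compactOperator (RingHom.id ℂ) H H

/-- The swap operator `S` on `H ⊗ H`. -/
def swap : HilbertTensor H →L[ℂ] HilbertTensor H :=
  (TensorProduct.commIsometry ℂ H H).toLinearIsometry.toContinuousLinearMap.completion

variable {H}

/-- The elementary tensor `x ⊗ y` in `H ⊗ H`. -/
def tmul (x y : H) : HilbertTensor H := ofAlg (x ⊗ₜ[ℂ] y)

/-- The bounded operator `A ⊗ B` on `H ⊗ H`. -/
def opTensor (A B : H →L[ℂ] H) : HilbertTensor H →L[ℂ] HilbertTensor H :=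
  (TensorProduct.mapL A B).completion

theorem denseRange_ofAlg : DenseRange (ofAlg : H ⊗[ℂ] H → HilbertTensor H) :=
  UniformSpace.Completion.denseRange_coe

theorem inner_tmul (x y z w : H) :
    inner ℂ (tmul x y) (tmul z w) = inner ℂ x z * inner ℂ y w := by
  simp [tmul]

theorem swap_tmul (x y : H) : swap H (tmul x y) = tmul y x :=
  (ContinuousLinearMap.completion_apply_coe
    (TensorProduct.commIsometry ℂ H H).toLinearIsometry.toContinuousLinearMap (x ⊗ₜ[ℂ] y))

theorem opTensor_tmul (A B : H →L[ℂ] H) (x y : H) :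
    opTensor A B (tmul x y) = tmul (A x) (B y) :=
  ContinuousLinearMap.completion_apply_coe (TensorProduct.mapL A B) (x ⊗ₜ[ℂ] y)

theorem isCompactOperator_rankOne (x y : H) :
    IsCompactOperator (InnerProductSpace.rankOne ℂ x y) := by
  have h : IsCompactOperator (innerSL ℂ y) :=
    isCompactOperator_of_locallyCompactSpace_dom (T := innerSL ℂ y)
  exact h.clm_comp (ContinuousLinearMap.toSpanSingleton ℂ x)

/-- The compact operator `x y*`, that is, `z ↦ ⟨z, y⟩ x` (inner product linear in `z`). -/
def rankOneK (x y : H) : Compacts H :=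
  ⟨InnerProductSpace.rankOne ℂ x y, isCompactOperator_rankOne x y⟩

variable [CompleteSpace H]

/-- `U X U*` as a compact operator, for a unitary `U` and a compact operator `X`. -/
def conjK (U : unitary (H →L[ℂ] H)) (X : Compacts H) : Compacts H :=
  ⟨(U : H →L[ℂ] H) * (X : H →L[ℂ] H) * star (U : H →L[ℂ] H), by
    have hX : IsCompactOperator (X : H →L[ℂ] H) := X.2
    exact (hX.clm_comp (U : H →L[ℂ] H)).comp_clm (star (U : H →L[ℂ] H))⟩

/-- `Ψ (U X U*) = (U ⊗ U) Ψ(X) (U* ⊗ U*)` for a given compact operator `X` and all unitaries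
`U`. -/
def IsCovariantAt (Ψ : Compacts H →L[ℂ] (HilbertTensor H →L[ℂ] HilbertTensor H))
    (X : Compacts H) : Prop :=
  ∀ U : unitary (H →L[ℂ] H),
    Ψ (conjK U X) =
      opTensor (U : H →L[ℂ] H) (U : H →L[ℂ] H) * Ψ X *
        opTensor (star (U : H →L[ℂ] H)) (star (U : H →L[ℂ] H))

/-- Covariance under unitary evolution. -/
def IsCovariant (Ψ : Compacts H →L[ℂ] (HilbertTensor H →L[ℂ] HilbertTensor H)) : Prop :=
  ∀ X : Compacts H, IsCovariantAt Ψ X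

end UnitaryCovariance

end

open UnitaryCovariance

/-! The map is studied through its matrix coefficients `F a b c d X = ⟪c ⊗ d, Ψ X (a ⊗ b)⟫`.
Covariance at one projection `ee*` spreads to all rank-one projections, by transitivity of the
unitary group on unit vectors. These projections determine `Ψ`, by polarization and density
(`dense_span_rankOneK`).

Fix `P = ee*` and let each argument be `e` or orthogonal to `e`. Rotating the phase of `e` kills
every coefficient where `e` occurs unequally often in `(a, b)` and in `(c, d)`. If `e` does not
occur at all, the coefficient has the same value `κ` at `n` further orthogonal projections, whose
sum has norm at most 1; continuity and infinite dimension give `κ = 0`. If `e` occurs once on each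
side, there are four types, each fixed by one scalar (transitivity on orthonormal pairs, then
polarization). Subtracting a combination of the four basic maps makes these scalars zero.

Only `F e e e e P` then remains. It would make `F e e e e (uu*)` proportional to `|⟪u, e⟫|⁴`, which
is incompatible with `uu* + vv* = ee* + ff*` for two orthonormal bases of a plane
(`apply_self_eq_zero`). Hence the difference is zero (`eq_zero`). -/

noncomputable section

namespace UnitaryCovariance

/-! ### Complex reflections and transitivity of the unitary group -/

section Unitaries

variable {H : Type*} [NormedAddCommGroup H] [InnerProductSpace ℂ H]

/-- The product expands to `1 + (σ + τ + στ‖v‖²) v v*`, since `(v v*)² = ‖v‖² v v*`. -/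
theorem one_add_smul_rankOne_mul (v : H) {σ τ : ℂ} (h : σ + τ + σ * τ * inner ℂ v v = 0) :
    (1 + σ • InnerProductSpace.rankOne ℂ v v : H →L[ℂ] H) *
      (1 + τ • InnerProductSpace.rankOne ℂ v v) = 1 := by
  ext z
  simp only [mul_apply_eq_comp, add_apply, one_apply_eq_self, smul_apply,
    InnerProductSpace.rankOne_apply, inner_add_right, inner_smul_right]
  linear_combination (norm := module) (inner ℂ v z * h) • v

variable [CompleteSpace H]

/-- A rank-one perturbation `1 + τ v v*` of the identity is unitary as soon as
`τ + τ̄ + τ τ̄ ‖v‖² = 0`. -/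
theorem one_add_smul_rankOne_mem_unitary (v : H) (τ : ℂ)
    (hτ : τ + star τ + τ * star τ * inner ℂ v v = 0) :
    (1 + τ • InnerProductSpace.rankOne ℂ v v : H →L[ℂ] H) ∈ unitary (H →L[ℂ] H) := by
  have hs : star (1 + τ • InnerProductSpace.rankOne ℂ v v : H →L[ℂ] H)
      = 1 + star τ • InnerProductSpace.rankOne ℂ v v := by
    rw [star_add, star_smul, star_one, ContinuousLinearMap.star_eq_adjoint,
      InnerProductSpace.adjoint_rankOne]
  rw [Unitary.mem_iff, hs]
  exact ⟨one_add_smul_rankOne_mul v (by linear_combination hτ), one_add_smul_rankOne_mul v hτ⟩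

/-- Any unit vector can be carried to any other one by a unitary (a complex reflection) which
fixes the orthogonal complement of both. -/
theorem exists_unitary_map_eq {x y : H} (hx : ‖x‖ = 1) (hy : ‖y‖ = 1) :
    ∃ U : unitary (H →L[ℂ] H), (U : H →L[ℂ] H) x = y ∧
      ∀ w : H, inner ℂ x w = 0 → inner ℂ y w = 0 → (U : H →L[ℂ] H) w = w := by
  rcases eq_or_ne x y with rfl | hxy
  · exact ⟨1, by simp, by simp⟩
  have hxx : inner ℂ x x = 1 := by simp [inner_self_eq_norm_sq_to_K, hx]
  have hyy : inner ℂ y y = 1 := by simp [inner_self_eq_norm_sq_to_K, hy]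
  have hc : inner ℂ x y = star (inner ℂ y x) := (inner_conj_symm x y).symm
  have hne : (1 : ℂ) - inner ℂ y x ≠ 0 := fun h =>
    hxy ((inner_eq_one_iff_of_norm_eq_one (𝕜 := ℂ) hy hx).1 (sub_eq_zero.1 h).symm).symm
  have hne' : (1 : ℂ) - star (inner ℂ y x) ≠ 0 := by
    intro h
    apply hne
    simpa using congrArg star h
  -- Since `⟪x - y, x⟫ = 1 - ⟪y, x⟫`, this scalar sends `x` to `x - (x - y) = y`; unitarity is `‖x -
  -- y‖² = (1 - ⟪y, x⟫) + (1 - ⟪x, y⟫)`.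
  refine ⟨⟨_, one_add_smul_rankOne_mem_unitary (x - y) (-(1 - inner ℂ y x)⁻¹) ?_⟩, ?_, ?_⟩
  · simp only [inner_sub_left, inner_sub_right, hxx, hyy, hc, star_neg, star_inv₀, star_sub,
      star_one]
    field_simp
    ring
  · simp only [add_apply, one_apply_eq_self, smul_apply, InnerProductSpace.rankOne_apply,
      inner_sub_left, hxx, smul_smul, neg_mul, inv_mul_cancel₀ hne]
    simp
  · intro w h₁ h₂
    simp [h₁, h₂]

theorem conjK_rankOneK (U : unitary (H →L[ℂ] H)) (x y : H) :
    conjK U (rankOneK x y) = rankOneK ((U : H →L[ℂ] H) x) ((U : H →L[ℂ] H) y) := by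
  apply Subtype.ext
  ext z
  simp [conjK, rankOneK, ContinuousLinearMap.star_eq_adjoint,
    ContinuousLinearMap.adjoint_inner_right]

end Unitaries

/-! ### Orthonormal families and density of finite-rank operators -/

section Orthonormal

variable {H : Type*} [NormedAddCommGroup H] [InnerProductSpace ℂ H]

/-- In an infinite-dimensional space there are arbitrarily long orthonormal families orthogonal to
a given finite-dimensional subspace. -/
theorem exists_orthonormal_orthogonal (hH : ¬ FiniteDimensional ℂ H) (W : Submodule ℂ H)
    [FiniteDimensional ℂ W] (n : ℕ) :
    ∃ v : Fin n → H, Orthonormal ℂ v ∧ ∀ i, v i ∈ Wᗮ := by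
  have hW : ¬ FiniteDimensional ℂ Wᗮ := by
    intro h
    apply hH
    have : FiniteDimensional ℂ (W ⊔ Wᗮ : Submodule ℂ H) := inferInstance
    rw [Submodule.sup_orthogonal_of_hasOrthogonalProjection] at this
    exact Module.Finite.equiv (Submodule.topEquiv (R := ℂ) (M := H))
  have hr : (n : Cardinal) ≤ Module.rank ℂ Wᗮ :=
    (Cardinal.natCast_le_aleph0).trans
      (not_lt.1 fun h => hW (Module.rank_lt_aleph0_iff.1 h))
  obtain ⟨f, hf⟩ := exists_linearIndependent_of_le_rank hr
  have hfin := finrank_span_eq_card hf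
  rw [Fintype.card_fin] at hfin
  have : FiniteDimensional ℂ (Submodule.span ℂ (Set.range f)) :=
    FiniteDimensional.span_of_finite ℂ (Set.finite_range f)
  let b := (stdOrthonormalBasis ℂ (Submodule.span ℂ (Set.range f))).reindex (finCongr hfin)
  refine ⟨fun i => ((b i : Wᗮ) : H), ?_, fun i => (b i : Wᗮ).2⟩
  have h := (b.orthonormal.comp_linearIsometry
    (Submodule.span ℂ (Set.range f)).subtypeₗᵢ).comp_linearIsometry (Wᗮ).subtypeₗᵢ
  exact h

/-- The projection onto the span of a finite orthonormal family is a contraction. -/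
theorem norm_sum_rankOneK_le {n : ℕ} {v : Fin n → H} (hv : Orthonormal ℂ v) :
    ‖∑ i, rankOneK (v i) (v i)‖ ≤ 1 := by
  rw [Submodule.coe_norm, Submodule.coe_sum]
  refine ContinuousLinearMap.opNorm_le_bound _ zero_le_one fun x => ?_
  have h1 : (∑ i, (rankOneK (v i) (v i) : H →L[ℂ] H)) x = ∑ i, (inner ℂ (v i) x) • v i := by
    simp [rankOneK]
  rw [h1, one_mul]
  refine le_of_sq_le_sq ?_ (norm_nonneg _)
  refine le_trans (le_of_eq ?_) (hv.sum_inner_products_le (s := Finset.univ) (x := x))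
  have h2 := hv.inner_sum (fun i => inner ℂ (v i) x) (fun i => inner ℂ (v i) x) Finset.univ
  rw [inner_self_eq_norm_sq_to_K] at h2
  have h3 : ((‖∑ i, inner ℂ (v i) x • v i‖ ^ 2 : ℝ) : ℂ)
      = ((∑ i, ‖inner ℂ (v i) x‖ ^ 2 : ℝ) : ℂ) := by
    push_cast
    refine h2.trans (Finset.sum_congr rfl fun i _ => ?_)
    exact RCLike.conj_mul _
  exact_mod_cast h3

/-- Compact operators with values in a finite-dimensional range are combinations of rank-one
operators. -/
theorem mem_span_rankOneK_of_projection [CompleteSpace H] (X : Compacts H) (W : Submodule ℂ H)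
    [FiniteDimensional ℂ W] (Y : Compacts H)
    (hY : (Y : H →L[ℂ] H) = W.starProjection ∘L (X : H →L[ℂ] H)) :
    Y ∈ Submodule.span ℂ (Set.range fun p : H × H => rankOneK p.1 p.2) := by
  have : Y = ∑ i, rankOneK (stdOrthonormalBasis ℂ W i : H)
      (ContinuousLinearMap.adjoint (X : H →L[ℂ] H) (stdOrthonormalBasis ℂ W i : H)) := by
    apply Subtype.ext
    rw [Submodule.coe_sum, hY, (stdOrthonormalBasis ℂ W).starProjection_eq_sum_rankOne]
    ext z
    simp [rankOneK, ContinuousLinearMap.adjoint_inner_left]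
  rw [this]
  exact Submodule.sum_mem _ fun i _ => Submodule.subset_span ⟨(_, _), rfl⟩

/-- Rank-one operators span a dense subspace of the compact operators on a Hilbert space. -/
theorem dense_span_rankOneK [CompleteSpace H] :
    Dense (Submodule.span ℂ (Set.range fun p : H × H => rankOneK p.1 p.2) : Set (Compacts H)) := by
  intro X
  rw [Metric.mem_closure_iff]
  intro ε hε
  have hX : IsCompactOperator (X : H →L[ℂ] H) := X.2
  have htb := (hX.isCompact_closure_image_closedBall 1).totallyBounded.subset subset_closure
  -- The span of a finite `ε / 2`-net of the image of the unit ball is used as `W`: projecting onto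
  -- it moves each `X x` no further than the nearest net point.
  obtain ⟨t, htf, ht⟩ := Metric.totallyBounded_iff.1 htb (ε / 2) (half_pos hε)
  have : FiniteDimensional ℂ (Submodule.span ℂ t) := FiniteDimensional.span_of_finite ℂ htf
  set W := Submodule.span ℂ t
  let Y : Compacts H := ⟨W.starProjection ∘L (X : H →L[ℂ] H), hX.clm_comp W.starProjection⟩
  refine ⟨Y, mem_span_rankOneK_of_projection X W Y rfl, ?_⟩
  rw [dist_eq_norm]
  refine lt_of_le_of_lt (b := ε / 2) ?_ (half_lt_self hε)
  rw [Submodule.coe_norm, Submodule.coe_sub]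
  refine ContinuousLinearMap.opNorm_le_of_unit_norm (half_pos hε).le fun x hx => ?_
  obtain ⟨y, hy, hxy⟩ := Set.mem_iUnion₂.1 (ht ⟨x, by simp [hx], rfl⟩)
  have hyW : y ∈ W := Submodule.subset_span hy
  refine le_trans ?_ (le_of_lt (mem_ball_iff_norm.1 hxy))
  have hmin := W.starProjection_minimal ((X : H →L[ℂ] H) x)
  exact hmin.trans_le (ciInf_le ⟨0, by rintro _ ⟨w, rfl⟩; exact norm_nonneg _⟩ (⟨y, hyW⟩ : W))

end Orthonormal

section

/-! ### Polarization -/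

section Polarization

variable {H : Type*} [NormedAddCommGroup H] [InnerProductSpace ℂ H]

/-- Polarization: a sesquilinear form which vanishes on the diagonal of a subspace vanishes on that
subspace. -/
theorem eq_zero_of_diag_eq_zero (B : H → H → ℂ) (W : Submodule ℂ H)
    (add_left : ∀ x x' y, B (x + x') y = B x y + B x' y)
    (smul_left : ∀ (r : ℂ) x y, B (r • x) y = r * B x y)
    (add_right : ∀ x y y', B x (y + y') = B x y + B x y')
    (smul_right : ∀ (r : ℂ) x y, B x (r • y) = star r * B x y)
    (hB : ∀ w ∈ W, ‖w‖ = 1 → B w w = 0) {x y : H} (hx : x ∈ W) (hy : y ∈ W) : B x y = 0 := by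
  have hdiag : ∀ w ∈ W, B w w = 0 := by
    intro w hw
    rcases eq_or_ne w 0 with rfl | h0
    · simpa using smul_left 0 0 0
    have hn : (‖w‖ : ℂ) ≠ 0 := by exact_mod_cast norm_ne_zero_iff.2 h0
    have h1 := hB _ (W.smul_mem ((‖w‖ : ℂ)⁻¹) hw) (by
      rw [norm_smul, norm_inv, Complex.norm_real, norm_norm,
        inv_mul_cancel₀ (norm_ne_zero_iff.2 h0)])
    rw [smul_left, smul_right] at h1
    simpa [hn] using h1
  -- The diagonal at `x + y` and `x + i y` gives the sum and the difference of `B x y` and `B y x`.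
  have h1 := hdiag _ (W.add_mem hx hy)
  have h2 := hdiag _ (W.add_mem hx (W.smul_mem Complex.I hy))
  simp only [add_left, add_right, smul_left, smul_right, hdiag x hx, hdiag y hy,
    Complex.star_def, Complex.conj_I] at h1 h2
  linear_combination (1 / 2 : ℂ) * h1 + (Complex.I / 2) * h2
    + (B x y / 2 - B y x / 2) * Complex.I_sq

end Polarization

/-! ### Invariant forms and their coefficients at a rank-one projection -/

variable {H : Type*} [NormedAddCommGroup H] [InnerProductSpace ℂ H] [CompleteSpace H]

/-- Families of functionals on the compact operators, linear in the first two and conjugate linear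
in the last two indices, which are invariant under unitary conjugation of rank-one projections. The
matrix coefficients `⟪c ⊗ d, Ψ X (a ⊗ b)⟫` of a covariant map are the main example. -/
structure IsInvariantForm (F : H → H → H → H → Compacts H →L[ℂ] ℂ) : Prop where
  add₁ : ∀ a a' b c d, F (a + a') b c d = F a b c d + F a' b c d
  add₂ : ∀ a b b' c d, F a (b + b') c d = F a b c d + F a b' c d
  add₃ : ∀ a b c c' d, F a b (c + c') d = F a b c d + F a b c' d
  add₄ : ∀ a b c d d', F a b c (d + d') = F a b c d + F a b c d'
  smul₁ : ∀ (r : ℂ) a b c d, F (r • a) b c d = r • F a b c d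
  smul₂ : ∀ (r : ℂ) a b c d, F a (r • b) c d = r • F a b c d
  smul₃ : ∀ (r : ℂ) a b c d, F a b (r • c) d = star r • F a b c d
  smul₄ : ∀ (r : ℂ) a b c d, F a b c (r • d) = star r • F a b c d
  inv : ∀ (U : unitary (H →L[ℂ] H)) (e a b c d : H), ‖e‖ = 1 →
    F ((U : H →L[ℂ] H) a) ((U : H →L[ℂ] H) b) ((U : H →L[ℂ] H) c) ((U : H →L[ℂ] H) d)
      (rankOneK ((U : H →L[ℂ] H) e) ((U : H →L[ℂ] H) e)) = F a b c d (rankOneK e e)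

namespace IsInvariantForm

variable {F G : H → H → H → H → Compacts H →L[ℂ] ℂ}

theorem add (hF : IsInvariantForm F) (hG : IsInvariantForm G) :
    IsInvariantForm fun a b c d => F a b c d + G a b c d where
  add₁ a a' b c d := by simp only [hF.add₁, hG.add₁]; abel
  add₂ a a' b c d := by simp only [hF.add₂, hG.add₂]; abel
  add₃ a a' b c d := by simp only [hF.add₃, hG.add₃]; abel
  add₄ a a' b c d := by simp only [hF.add₄, hG.add₄]; abel
  smul₁ r a b c d := by simp only [hF.smul₁, hG.smul₁, smul_add]
  smul₂ r a b c d := by simp only [hF.smul₂, hG.smul₂, smul_add]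
  smul₃ r a b c d := by simp only [hF.smul₃, hG.smul₃, smul_add]
  smul₄ r a b c d := by simp only [hF.smul₄, hG.smul₄, smul_add]
  inv U e a b c d he := by simp only [add_apply, hF.inv U e _ _ _ _ he, hG.inv U e _ _ _ _ he]

theorem const_smul (hF : IsInvariantForm F) (s : ℂ) :
    IsInvariantForm fun a b c d => s • F a b c d where
  add₁ a a' b c d := by simp only [hF.add₁, smul_add]
  add₂ a a' b c d := by simp only [hF.add₂, smul_add]
  add₃ a a' b c d := by simp only [hF.add₃, smul_add]
  add₄ a a' b c d := by simp only [hF.add₄, smul_add]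
  smul₁ r a b c d := by simp only [hF.smul₁, smul_comm s r]
  smul₂ r a b c d := by simp only [hF.smul₂, smul_comm s r]
  smul₃ r a b c d := by simp only [hF.smul₃, smul_comm s (star r)]
  smul₄ r a b c d := by simp only [hF.smul₄, smul_comm s (star r)]
  inv U e a b c d he := by simp only [smul_apply, hF.inv U e _ _ _ _ he]

/-- Invariance under a unitary carrying the unit vector `e` to `e'` and fixing vectors orthogonal to
both. -/
theorem apply_eq_of_orthogonal (hF : IsInvariantForm F) {e e' a b c d : H} (he : ‖e‖ = 1)
    (he' : ‖e'‖ = 1) (ha : inner ℂ e a = 0) (hb : inner ℂ e b = 0) (hc : inner ℂ e c = 0)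
    (hd : inner ℂ e d = 0) (ha' : inner ℂ e' a = 0) (hb' : inner ℂ e' b = 0)
    (hc' : inner ℂ e' c = 0) (hd' : inner ℂ e' d = 0) :
    F a b c d (rankOneK e e) = F a b c d (rankOneK e' e') := by
  obtain ⟨U, hU, hfix⟩ := exists_unitary_map_eq he he'
  have h := hF.inv U e a b c d he
  rw [hU, hfix a ha ha', hfix b hb hb', hfix c hc hc', hfix d hd hd'] at h
  exact h.symm

/-- In infinite dimension, boundedness forces the coefficients on the orthogonal complement of `e`
to vanish. -/
theorem apply_eq_zero_of_orthogonal (hF : IsInvariantForm F) (hH : ¬ FiniteDimensional ℂ H)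
    {e a b c d : H} (he : ‖e‖ = 1) (ha : inner ℂ e a = 0) (hb : inner ℂ e b = 0)
    (hc : inner ℂ e c = 0) (hd : inner ℂ e d = 0) : F a b c d (rankOneK e e) = 0 := by
  by_contra hne
  set κ := F a b c d (rankOneK e e) with hκ
  have hpos : 0 < ‖κ‖ := norm_pos_iff.2 hne
  -- Each `v i` below can replace `e` without changing the value, so `F` equals `nκ` on an operator
  -- of norm at most 1; this `n` makes `n‖κ‖` exceed `‖F a b c d‖`.
  obtain ⟨n, hn⟩ := exists_nat_gt (‖F a b c d‖ / ‖κ‖)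
  let W := Submodule.span ℂ ({a, b, c, d} : Set H)
  have : FiniteDimensional ℂ W := FiniteDimensional.span_of_finite ℂ (by simp)
  obtain ⟨v, hv, hvW⟩ := exists_orthonormal_orthogonal hH W n
  have horth : ∀ i, ∀ w ∈ ({a, b, c, d} : Set H), inner ℂ (v i) w = 0 := fun i w hw =>
    (Submodule.mem_orthogonal' _ _).1 (hvW i) w (Submodule.subset_span hw)
  have h1 : F a b c d (∑ i, rankOneK (v i) (v i)) = n * κ := by
    rw [map_sum, Finset.sum_congr rfl (g := fun _ => κ)]
    · simp
    · intro i _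
      exact (hF.apply_eq_of_orthogonal he (hv.1 i) ha hb hc hd (horth i a (by simp))
        (horth i b (by simp)) (horth i c (by simp)) (horth i d (by simp))).symm
  have h2 := (F a b c d).le_of_opNorm_le_of_le le_rfl (norm_sum_rankOneK_le hv)
  rw [h1, norm_mul, mul_one, Complex.norm_natCast] at h2
  rw [div_lt_iff₀ hpos] at hn
  exact absurd h2 (not_le.2 hn)

/-- Coefficients with different weights under the phase rotation of `e` vanish. -/
theorem apply_eq_zero_of_phase (hF : IsInvariantForm F) {e a b c d : H} (he : ‖e‖ = 1)
    {za zb zc zd : ℂ}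
    (hz : za * zb * star zc * star zd ≠ 1)
    (ha : (a = e ∧ za = Complex.I) ∨ (inner ℂ e a = 0 ∧ za = 1))
    (hb : (b = e ∧ zb = Complex.I) ∨ (inner ℂ e b = 0 ∧ zb = 1))
    (hc : (c = e ∧ zc = Complex.I) ∨ (inner ℂ e c = 0 ∧ zc = 1))
    (hd : (d = e ∧ zd = Complex.I) ∨ (inner ℂ e d = 0 ∧ zd = 1)) :
    F a b c d (rankOneK e e) = 0 := by
  -- The rotation `e ↦ i e` fixes `ee*` and multiplies the coefficient by a power of `i` with
  -- exponent between -2 and 2, which is 1 only for exponent 0.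
  obtain ⟨U, hU, hfix⟩ := exists_unitary_map_eq (x := e) (y := Complex.I • e) he
    (by simp [norm_smul, he])
  have hmap : ∀ {w : H} {z : ℂ}, (w = e ∧ z = Complex.I) ∨ (inner ℂ e w = 0 ∧ z = 1) →
      (U : H →L[ℂ] H) w = z • w := by
    rintro w z (⟨rfl, rfl⟩ | ⟨h, rfl⟩)
    · exact hU
    · rw [hfix w h (by rw [inner_smul_left, h, mul_zero]), one_smul]
  have hr : rankOneK (Complex.I • e) (Complex.I • e) = rankOneK e e := by
    apply Subtype.ext
    ext w
    simp [rankOneK, smul_smul]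
  have h := hF.inv U e a b c d he
  rw [hU, hr, hmap ha, hmap hb, hmap hc, hmap hd, hF.smul₁, hF.smul₂, hF.smul₃, hF.smul₄] at h
  simp only [smul_apply, smul_eq_mul] at h
  have h' : (za * zb * star zc * star zd - 1) * F a b c d (rankOneK e e) = 0 := by
    linear_combination h
  exact (mul_eq_zero.1 h').resolve_left (sub_ne_zero.2 hz)

/-- The four types of coefficients which are not forced to vanish by invariance. -/
structure VanishesOnPair (F : H → H → H → H → Compacts H →L[ℂ] ℂ) (e f : H) : Prop where
  ef_ef : F e f e f (rankOneK e e) = 0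
  ef_fe : F e f f e (rankOneK e e) = 0
  fe_ef : F f e e f (rankOneK e e) = 0
  fe_fe : F f e f e (rankOneK e e) = 0

theorem VanishesOnPair.map (hF : IsInvariantForm F) {e f : H} (he : ‖e‖ = 1)
    (h : VanishesOnPair F e f) (U : unitary (H →L[ℂ] H)) :
    VanishesOnPair F ((U : H →L[ℂ] H) e) ((U : H →L[ℂ] H) f) where
  ef_ef := (hF.inv U e _ _ _ _ he).trans h.ef_ef
  ef_fe := (hF.inv U e _ _ _ _ he).trans h.ef_fe
  fe_ef := (hF.inv U e _ _ _ _ he).trans h.fe_ef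
  fe_fe := (hF.inv U e _ _ _ _ he).trans h.fe_fe

/-- Unitaries act transitively on orthonormal pairs. -/
theorem VanishesOnPair.of_orthonormal (hF : IsInvariantForm F) {e f e' f' : H} (he : ‖e‖ = 1)
    (hf : ‖f‖ = 1) (hef : inner ℂ e f = 0) (he' : ‖e'‖ = 1) (hf' : ‖f'‖ = 1)
    (hef' : inner ℂ e' f' = 0) (h : VanishesOnPair F e f) : VanishesOnPair F e' f' := by
  obtain ⟨U, hU, -⟩ := exists_unitary_map_eq he he'
  have h₁ := h.map hF he U
  rw [hU] at h₁
  have hUf : inner ℂ e' ((U : H →L[ℂ] H) f) = 0 := by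
    rw [← hU, Unitary.inner_map_map, hef]
  -- Both `U f` and `f'` are orthogonal to `e'`, so `V` keeps `e'` in place.
  obtain ⟨V, hV, hfix⟩ := exists_unitary_map_eq
    (x := (U : H →L[ℂ] H) f) (y := f') (by rw [Unitary.norm_map, hf]) hf'
  have h₂ := h₁.map hF he' V
  rwa [hV, hfix e' (inner_eq_zero_symm.1 hUf) (inner_eq_zero_symm.1 hef')] at h₂

/-- A pair of orthogonal vectors in the complement of `e` also gives vanishing coefficients. -/
theorem mixed_eq_zero (hF : IsInvariantForm F) {e : H}
    (h : ∀ f : H, ‖f‖ = 1 → inner ℂ e f = 0 → VanishesOnPair F e f) {f g : H}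
    (hf : inner ℂ e f = 0) (hg : inner ℂ e g = 0) :
    F e f e g (rankOneK e e) = 0 ∧ F e f g e (rankOneK e e) = 0 ∧
      F f e e g (rankOneK e e) = 0 ∧ F f e g e (rankOneK e e) = 0 := by
  have hmem : ∀ {w : H}, inner ℂ e w = 0 ↔ w ∈ (ℂ ∙ e)ᗮ := fun {w} =>
    Submodule.mem_orthogonal_singleton_iff_inner_right.symm
  rw [hmem] at hf hg
  refine ⟨?_, ?_, ?_, ?_⟩
  · exact eq_zero_of_diag_eq_zero (fun f g => F e f e g (rankOneK e e)) _
      (by simp [hF.add₂]) (by simp [hF.smul₂]) (by simp [hF.add₄]) (by simp [hF.smul₄])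
      (fun w hw hn => (h w hn (hmem.2 hw)).ef_ef) hf hg
  · exact eq_zero_of_diag_eq_zero (fun f g => F e f g e (rankOneK e e)) _
      (by simp [hF.add₂]) (by simp [hF.smul₂]) (by simp [hF.add₃]) (by simp [hF.smul₃])
      (fun w hw hn => (h w hn (hmem.2 hw)).ef_fe) hf hg
  · exact eq_zero_of_diag_eq_zero (fun f g => F f e e g (rankOneK e e)) _
      (by simp [hF.add₁]) (by simp [hF.smul₁]) (by simp [hF.add₄]) (by simp [hF.smul₄])
      (fun w hw hn => (h w hn (hmem.2 hw)).fe_ef) hf hg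
  · exact eq_zero_of_diag_eq_zero (fun f g => F f e g e (rankOneK e e)) _
      (by simp [hF.add₁]) (by simp [hF.smul₁]) (by simp [hF.add₃]) (by simp [hF.smul₃])
      (fun w hw hn => (h w hn (hmem.2 hw)).fe_fe) hf hg

/-- Splitting each argument along `e` and its complement yields 16 terms: one vanishes by
boundedness, four are the mixed ones, ten vanish by phase, and the all-`e` term survives. -/
theorem apply_rankOneK_eq (hF : IsInvariantForm F) (hH : ¬ FiniteDimensional ℂ H) {e : H}
    (he : ‖e‖ = 1) (h : ∀ f : H, ‖f‖ = 1 → inner ℂ e f = 0 → VanishesOnPair F e f)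
    (a b c d : H) :
    F a b c d (rankOneK e e) =
      inner ℂ e a * inner ℂ e b * inner ℂ c e * inner ℂ d e * F e e e e (rankOneK e e) := by
  have hee : inner ℂ e e = 1 := by simp [inner_self_eq_norm_sq_to_K, he]
  have hdec : ∀ w : H, ∃ w', inner ℂ e w' = 0 ∧ w = inner ℂ e w • e + w' := fun w =>
    ⟨w - inner ℂ e w • e, by rw [inner_sub_right, inner_smul_right, hee, mul_one, sub_self], by abel⟩
  have hI : (1 : ℂ) ≠ Complex.I := fun h => by simpa using congrArg Complex.re h
  have hI' : Complex.I ≠ 1 := hI.symm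
  have hnI : -Complex.I ≠ 1 := fun h => by simpa using congrArg Complex.re h
  have hn1 : (-1 : ℂ) ≠ 1 := by norm_num
  have hconj : ∀ w : H, star (inner ℂ e w) = inner ℂ w e := fun w => inner_conj_symm w e
  obtain ⟨a', ha', hae⟩ := hdec a
  obtain ⟨b', hb', hbe⟩ := hdec b
  obtain ⟨c', hc', hce⟩ := hdec c
  obtain ⟨d', hd', hde⟩ := hdec d
  have E : (e = e ∧ Complex.I = Complex.I) ∨ (inner ℂ e e = 0 ∧ Complex.I = 1) := by simp
  have O : ∀ {w : H}, inner ℂ e w = 0 → (w = e ∧ (1 : ℂ) = Complex.I) ∨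
    (inner ℂ e w = 0 ∧ (1 : ℂ) = 1) := fun h => Or.inr ⟨h, rfl⟩
  have P : ∀ {a b c d : H} {za zb zc zd : ℂ}, _ → _ → _ → _ → _ → _ :=
    fun {a b c d} {za zb zc zd} ha hb hc hd hz =>
      hF.apply_eq_zero_of_phase (a := a) (b := b) (c := c) (d := d)
        (za := za) (zb := zb) (zc := zc) (zd := zd) he hz ha hb hc hd
  rw [← hconj c, ← hconj d]
  -- Freeing the scalars from `a`, `b`, `c`, `d` lets the decompositions be substituted.
  generalize inner ℂ e a = α at hae ⊢
  generalize inner ℂ e b = β at hbe ⊢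
  generalize inner ℂ e c = γ at hce ⊢
  generalize inner ℂ e d = δ at hde ⊢
  subst hae hbe hce hde
  simp only [hF.add₁, hF.add₂, hF.add₃, hF.add₄, hF.smul₁, hF.smul₂, hF.smul₃, hF.smul₄,
    add_apply, smul_apply, smul_eq_mul]
  rw [hF.apply_eq_zero_of_orthogonal hH he ha' hb' hc' hd',
    (hF.mixed_eq_zero h ha' hc').2.2.2, (hF.mixed_eq_zero h ha' hd').2.2.1,
    (hF.mixed_eq_zero h hb' hc').2.1, (hF.mixed_eq_zero h hb' hd').1,
    P E E E (O hd') (by simp [hI']), P E E (O hc') E (by simp [hI']), P E E (O hc') (O hd') (by simp [hn1]),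
    P E (O hb') E E (by simp [hnI]), P E (O hb') (O hc') (O hd') (by simp [hI']),
    P (O ha') E E E (by simp [hnI]), P (O ha') E (O hc') (O hd') (by simp [hI']),
    P (O ha') (O hb') E E (by simp [hn1]), P (O ha') (O hb') E (O hd') (by simp [hnI]),
    P (O ha') (O hb') (O hc') E (by simp [hnI])]
  ring

end IsInvariantForm

end

/-! ### Elementary tensors and matrix coefficients -/

section TensorLemmas

variable {H : Type*} [NormedAddCommGroup H] [InnerProductSpace ℂ H]

theorem tmul_add (x y y' : H) : tmul x (y + y') = tmul x y + tmul x y' := by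
  simp [tmul, TensorProduct.tmul_add]

theorem add_tmul (x x' y : H) : tmul (x + x') y = tmul x y + tmul x' y := by
  simp [tmul, TensorProduct.add_tmul]

theorem tmul_smul (r : ℂ) (x y : H) : tmul x (r • y) = r • tmul x y := by
  simp [tmul]

theorem smul_tmul (r : ℂ) (x y : H) : tmul (r • x) y = r • tmul x y := by
  rw [tmul, tmul, ← TensorProduct.smul_tmul', map_smul]

/-- Bounded operators on `H ⊗ H` are determined by their values on elementary tensors. -/
theorem ext_tmul {E : Type*} [NormedAddCommGroup E] [NormedSpace ℂ E]
    {T S : HilbertTensor H →L[ℂ] E} (h : ∀ x y : H, T (tmul x y) = S (tmul x y)) : T = S := by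
  apply ContinuousLinearMap.coeFn_injective
  refine denseRange_ofAlg.equalizer T.continuous S.continuous (funext fun t => ?_)
  induction t using TensorProduct.induction_on with
  | zero => simp
  | tmul x y => exact h x y
  | add t₁ t₂ h₁ h₂ =>
    simp only [Function.comp_apply, map_add] at h₁ h₂ ⊢
    rw [h₁, h₂]

theorem ext_inner_tmul {z z' : HilbertTensor H}
    (h : ∀ x y : H, inner ℂ (tmul x y) z = inner ℂ (tmul x y) z') : z = z' := by
  have : innerSL ℂ z = innerSL ℂ z' := ext_tmul fun x y => by
    rw [innerSL_apply_apply, innerSL_apply_apply, ← inner_conj_symm, h, inner_conj_symm]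
  refine ext_inner_right ℂ fun v => ?_
  simpa using congrArg (fun T : HilbertTensor H →L[ℂ] ℂ => T v) this

theorem opTensor_mul (A B C D : H →L[ℂ] H) :
    opTensor A B * opTensor C D = opTensor (A * C) (B * D) :=
  ext_tmul fun x y => by simp [opTensor_tmul]

theorem inner_tmul_opTensor [CompleteSpace H] (A B : H →L[ℂ] H) (x y : H) (z : HilbertTensor H) :
    inner ℂ (tmul x y) (opTensor A B z) = inner ℂ (tmul (star A x) (star B y)) z := by
  have : (innerSL ℂ (tmul x y)) ∘L opTensor A B = innerSL ℂ (tmul (star A x) (star B y)) :=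
    ext_tmul fun u v => by
      simp [opTensor_tmul, inner_tmul, ContinuousLinearMap.star_eq_adjoint,
        ContinuousLinearMap.adjoint_inner_left]
  exact congrArg (fun T : HilbertTensor H →L[ℂ] ℂ => T z) this

theorem add_rankOneK (x x' y : H) : rankOneK (x + x') y = rankOneK x y + rankOneK x' y :=
  Subtype.ext (by simp [rankOneK])

theorem rankOneK_add (x y y' : H) : rankOneK x (y + y') = rankOneK x y + rankOneK x y' :=
  Subtype.ext (by simp [rankOneK])

theorem smul_rankOneK (r : ℂ) (x y : H) : rankOneK (r • x) y = r • rankOneK x y :=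
  Subtype.ext (by simp [rankOneK])

theorem rankOneK_smul (r : ℂ) (x y : H) : rankOneK x (r • y) = star r • rankOneK x y :=
  Subtype.ext (by simp [rankOneK])

/-- The matrix entry `X ↦ ⟪d, X b⟫` of a compact operator. -/
def entry (b d : H) : Compacts H →L[ℂ] ℂ :=
  innerSL ℂ d ∘L ContinuousLinearMap.apply ℂ H b ∘L (Compacts H).subtypeL

theorem entry_apply (b d : H) (X : Compacts H) :
    entry b d X = inner ℂ d ((X : H →L[ℂ] H) b) := rfl

theorem entry_add_left (b b' d : H) : entry (b + b') d = entry b d + entry b' d := by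
  ext X; simp [entry_apply]

theorem entry_add_right (b d d' : H) : entry b (d + d') = entry b d + entry b d' := by
  ext X; simp [entry_apply]

theorem entry_smul_left (r : ℂ) (b d : H) : entry (r • b) d = r • entry b d := by
  ext X; simp [entry_apply]

theorem entry_smul_right (r : ℂ) (b d : H) : entry b (r • d) = star r • entry b d := by
  ext X; simp [entry_apply, mul_comm]

theorem entry_rankOneK (b d x y : H) :
    entry b d (rankOneK x y) = inner ℂ y b * inner ℂ d x := by
  simp [entry_apply, rankOneK]

/-- The matrix coefficient `X ↦ ⟪c ⊗ d, Ψ X (a ⊗ b)⟫`. -/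
def coeff (Ψ : Compacts H →L[ℂ] (HilbertTensor H →L[ℂ] HilbertTensor H)) (a b c d : H) :
    Compacts H →L[ℂ] ℂ :=
  innerSL ℂ (tmul c d) ∘L ContinuousLinearMap.apply ℂ (HilbertTensor H) (tmul a b) ∘L Ψ

theorem coeff_apply (Ψ : Compacts H →L[ℂ] (HilbertTensor H →L[ℂ] HilbertTensor H)) (a b c d : H)
    (X : Compacts H) : coeff Ψ a b c d X = inner ℂ (tmul c d) (Ψ X (tmul a b)) := rfl

end TensorLemmas

/-! ### Vanishing of invariant forms -/

variable {H : Type*} [NormedAddCommGroup H] [InnerProductSpace ℂ H] [CompleteSpace H]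

namespace IsInvariantForm

variable {F : H → H → H → H → Compacts H →L[ℂ] ℂ}

/-- Additivity of `F` on two orthonormal bases of the same plane forces the last coefficient to
vanish. -/
theorem apply_self_eq_zero (hF : IsInvariantForm F) (hH : ¬ FiniteDimensional ℂ H)
    (h : ∀ e f : H, ‖e‖ = 1 → ‖f‖ = 1 → inner ℂ e f = 0 → VanishesOnPair F e f) {e : H}
    (he : ‖e‖ = 1) : F e e e e (rankOneK e e) = 0 := by
  obtain ⟨w, hw, hwe⟩ := exists_orthonormal_orthogonal hH (ℂ ∙ e) 1
  obtain ⟨f, hf, hef⟩ : ∃ f : H, ‖f‖ = 1 ∧ inner ℂ e f = 0 :=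
    ⟨w 0, hw.1 0, Submodule.mem_orthogonal_singleton_iff_inner_right.1 (hwe 0)⟩
  have hfe : inner ℂ f e = 0 := inner_eq_zero_symm.1 hef
  have hee : inner ℂ e e = 1 := by simp [inner_self_eq_norm_sq_to_K, he]
  have hff : inner ℂ f f = 1 := by simp [inner_self_eq_norm_sq_to_K, hf]
  have hconst : ∀ u : H, ‖u‖ = 1 → F u u u u (rankOneK u u) = F e e e e (rankOneK e e) := by
    intro u hu
    obtain ⟨U, hU, -⟩ := exists_unitary_map_eq he hu
    rw [← hU]
    exact hF.inv U e e e e e he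
  have hnorm : ∀ u : H, inner ℂ u u = 1 → ‖u‖ = 1 := by
    intro u hu
    rw [inner_self_eq_norm_sq_to_K] at hu
    have : ‖u‖ ^ 2 = 1 := Complex.ofReal_injective (by simpa using hu)
    exact (pow_eq_one_iff_of_nonneg (norm_nonneg u) two_ne_zero).1 this
  have key : ∀ u : H, ‖u‖ = 1 → F e e e e (rankOneK u u) =
      inner ℂ u e * inner ℂ u e * inner ℂ e u * inner ℂ e u * F e e e e (rankOneK e e) := by
    intro u hu
    rw [hF.apply_rankOneK_eq hH hu (fun f hf huf => h u f hu hf huf), hconst u hu]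
  -- A rational rotation of `e, f`. With `κ = F e e e e (rankOneK e e)`, the two sides of `hsum`
  -- give `(81 + 256) / 625 * κ` and `κ`, hence `288 / 625 * κ = 0`.
  set u : H := (3 / 5 : ℂ) • e + (4 / 5 : ℂ) • f with hu
  set v : H := (4 / 5 : ℂ) • e + (-3 / 5 : ℂ) • f with hv
  have hsum : rankOneK u u + rankOneK v v = rankOneK e e + rankOneK f f := by
    simp only [hu, hv, add_rankOneK, rankOneK_add, smul_rankOneK, rankOneK_smul, smul_smul,
      smul_add, star_div₀, star_neg, star_ofNat]
    module
  have hun : ‖u‖ = 1 := hnorm u (by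
    simp only [hu, inner_add_left, inner_add_right, inner_smul_left, inner_smul_right, hee, hff,
      hef, hfe, map_div₀, map_ofNat]
    norm_num)
  have hvn : ‖v‖ = 1 := hnorm v (by
    simp only [hv, inner_add_left, inner_add_right, inner_smul_left, inner_smul_right, hee, hff,
      hef, hfe, map_div₀, map_neg, map_ofNat]
    norm_num)
  have hF' := congrArg (F e e e e) hsum
  rw [map_add, map_add, key u hun, key v hvn, key f hf] at hF'
  simp only [hu, hv, inner_add_left, inner_add_right, inner_smul_left, inner_smul_right, hee,
    hef, hfe, map_div₀, map_neg, map_ofNat] at hF'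
  linear_combination (-625 / 288 : ℂ) * hF'

/-- An invariant form vanishes as soon as four of its coefficients do. -/
theorem eq_zero (hF : IsInvariantForm F) (hH : ¬ FiniteDimensional ℂ H) {e f : H} (he : ‖e‖ = 1)
    (hf : ‖f‖ = 1) (hef : inner ℂ e f = 0) (h : VanishesOnPair F e f) (a b c d : H) :
    F a b c d = 0 := by
  have hall : ∀ e f : H, ‖e‖ = 1 → ‖f‖ = 1 → inner ℂ e f = 0 → VanishesOnPair F e f :=
    fun e' f' he' hf' hef' => h.of_orthonormal hF he hf hef he' hf' hef'
  have hr : ∀ x y : H, F a b c d (rankOneK x y) = 0 := fun x y =>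
    eq_zero_of_diag_eq_zero (fun x y => F a b c d (rankOneK x y)) ⊤
      (by simp [add_rankOneK]) (by simp [smul_rankOneK]) (by simp [rankOneK_add])
      (by simp [rankOneK_smul])
      (fun w _ hw => by
        rw [hF.apply_rankOneK_eq hH hw (fun f hf hwf => hall w f hw hf hwf),
          hF.apply_self_eq_zero hH hall hw, mul_zero])
      trivial trivial
  refine ContinuousLinearMap.ext_on dense_span_rankOneK ?_
  rintro _ ⟨p, rfl⟩
  exact hr p.1 p.2

end IsInvariantForm

/-! ### The basic forms, and the passage between forms and covariant maps -/

/-- These are the coefficients of `X ↦ I ⊗ X`. Exchanging the first two indices, the last two, or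
both gives those of `S(X ⊗ I)`, `S(I ⊗ X)` and `X ⊗ I`. -/
theorem isInvariantForm_one_tensor :
    IsInvariantForm fun a b c d : H => (inner ℂ c a : ℂ) • entry b d where
  add₁ a a' b c d := by ext X; simp [add_mul]
  add₂ a b b' c d := by rw [entry_add_left, smul_add]
  add₃ a b c c' d := by ext X; simp [add_mul]
  add₄ a b c d d' := by rw [entry_add_right, smul_add]
  smul₁ r a b c d := by rw [inner_smul_right, mul_smul]
  smul₂ r a b c d := by rw [entry_smul_left, smul_comm]
  smul₃ r a b c d := by rw [inner_smul_left, mul_smul]; rfl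
  smul₄ r a b c d := by rw [entry_smul_right, smul_comm]
  inv U e a b c d _ := by simp only [smul_apply, entry_rankOneK, Unitary.inner_map_map]

/-- Exchanging the first two indices. -/
theorem IsInvariantForm.swap_left {F : H → H → H → H → Compacts H →L[ℂ] ℂ}
    (hF : IsInvariantForm F) : IsInvariantForm fun a b c d => F b a c d where
  add₁ a a' b c d := hF.add₂ b a a' c d
  add₂ a b b' c d := hF.add₁ b b' a c d
  add₃ a b c c' d := hF.add₃ b a c c' d
  add₄ a b c d d' := hF.add₄ b a c d d'
  smul₁ r a b c d := hF.smul₂ r b a c d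
  smul₂ r a b c d := hF.smul₁ r b a c d
  smul₃ r a b c d := hF.smul₃ r b a c d
  smul₄ r a b c d := hF.smul₄ r b a c d
  inv U e a b c d he := hF.inv U e b a c d he

/-- Exchanging the last two indices. -/
theorem IsInvariantForm.swap_right {F : H → H → H → H → Compacts H →L[ℂ] ℂ}
    (hF : IsInvariantForm F) : IsInvariantForm fun a b c d => F a b d c where
  add₁ a a' b c d := hF.add₁ a a' b d c
  add₂ a b b' c d := hF.add₂ a b b' d c
  add₃ a b c c' d := hF.add₄ a b d c c'
  add₄ a b c d d' := hF.add₃ a b d d' c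
  smul₁ r a b c d := hF.smul₁ r a b d c
  smul₂ r a b c d := hF.smul₂ r a b d c
  smul₃ r a b c d := hF.smul₄ r a b d c
  smul₄ r a b c d := hF.smul₃ r a b d c
  inv U e a b c d he := hF.inv U e a b d c he

theorem conjK_conjK (U V : unitary (H →L[ℂ] H)) (X : Compacts H) :
    conjK U (conjK V X) = conjK (U * V) X :=
  Subtype.ext (by simp [conjK, mul_assoc])

theorem star_apply_apply (U : unitary (H →L[ℂ] H)) (x : H) :
    star (U : H →L[ℂ] H) ((U : H →L[ℂ] H) x) = x := by
  rw [← mul_apply_eq_comp, Unitary.star_mul_self_of_mem U.2, one_apply_eq_self]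

theorem apply_star_apply (U : unitary (H →L[ℂ] H)) (x : H) :
    (U : H →L[ℂ] H) (star (U : H →L[ℂ] H) x) = x := by
  rw [← mul_apply_eq_comp, Unitary.mul_star_self_of_mem U.2, one_apply_eq_self]

/-- Covariance at `X` implies covariance on the unitary orbit of `X`. -/
theorem IsCovariantAt.conjK {Ψ : Compacts H →L[ℂ] (HilbertTensor H →L[ℂ] HilbertTensor H)}
    {X : Compacts H} (h : IsCovariantAt Ψ X) (V : unitary (H →L[ℂ] H)) :
    IsCovariantAt Ψ (conjK V X) := by
  intro U
  rw [conjK_conjK, h (U * V), h V]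
  simp only [Submonoid.coe_mul, star_mul, ← opTensor_mul, mul_assoc]

/-- Every unit vector `w` is some `V e`, so covariance at `ee*` passes to `ww*` along the unitary
orbit. -/
theorem isInvariantForm_coeff {Ψ : Compacts H →L[ℂ] (HilbertTensor H →L[ℂ] HilbertTensor H)}
    {e : H} (he : ‖e‖ = 1) (h : IsCovariantAt Ψ (rankOneK e e)) : IsInvariantForm (coeff Ψ) where
  add₁ a a' b c d := by ext X; simp [coeff_apply, add_tmul]
  add₂ a b b' c d := by ext X; simp [coeff_apply, tmul_add]
  add₃ a b c c' d := by ext X; simp [coeff_apply, add_tmul]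
  add₄ a b c d d' := by ext X; simp [coeff_apply, tmul_add]
  smul₁ r a b c d := by ext X; simp [coeff_apply, smul_tmul]
  smul₂ r a b c d := by ext X; simp [coeff_apply, tmul_smul]
  smul₃ r a b c d := by ext X; simp [coeff_apply, smul_tmul, mul_comm]
  smul₄ r a b c d := by ext X; simp [coeff_apply, tmul_smul, mul_comm]
  inv U w a b c d hw := by
    obtain ⟨V, hV, -⟩ := exists_unitary_map_eq he hw
    have hcov := h.conjK V
    rw [conjK_rankOneK, hV] at hcov
    rw [coeff_apply, coeff_apply, ← conjK_rankOneK, hcov U, mul_apply_eq_comp, mul_apply_eq_comp,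
      opTensor_tmul, inner_tmul_opTensor]
    simp only [star_apply_apply]

/-- The four basic covariant maps sum up to a covariant map. -/
theorem isCovariant_of_eq {Ψ : Compacts H →L[ℂ] (HilbertTensor H →L[ℂ] HilbertTensor H)}
    {c₁ c₂ c₃ c₄ : ℂ} (h : ∀ X : Compacts H,
      Ψ X = c₁ • opTensor 1 (X : H →L[ℂ] H) + c₂ • opTensor (X : H →L[ℂ] H) 1
        + c₃ • (swap H * opTensor 1 (X : H →L[ℂ] H))
        + c₄ • (swap H * opTensor (X : H →L[ℂ] H) 1)) : IsCovariant Ψ := by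
  intro X U
  refine ext_tmul fun a b => ?_
  have hc : ∀ x : H, (conjK U X : H →L[ℂ] H) x
      = (U : H →L[ℂ] H) ((X : H →L[ℂ] H) (star (U : H →L[ℂ] H) x)) := fun _ => rfl
  simp only [h, mul_apply_eq_comp, add_apply, smul_apply, map_add, map_smul, opTensor_tmul,
    swap_tmul, one_apply_eq_self, hc, apply_star_apply]

theorem exists_eq_of_isCovariantAt (hH : ¬ FiniteDimensional ℂ H)
    {Ψ : Compacts H →L[ℂ] (HilbertTensor H →L[ℂ] HilbertTensor H)} {e : H} (he : ‖e‖ = 1)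
    (h : IsCovariantAt Ψ (rankOneK e e)) :
    ∃ c₁ c₂ c₃ c₄ : ℂ, ∀ X : Compacts H,
      Ψ X = c₁ • opTensor 1 (X : H →L[ℂ] H) + c₂ • opTensor (X : H →L[ℂ] H) 1
        + c₃ • (swap H * opTensor 1 (X : H →L[ℂ] H))
        + c₄ • (swap H * opTensor (X : H →L[ℂ] H) 1) := by
  obtain ⟨w, hw, hwe⟩ := exists_orthonormal_orthogonal hH (ℂ ∙ e) 1
  obtain ⟨f, hf, hef⟩ : ∃ f : H, ‖f‖ = 1 ∧ inner ℂ e f = 0 :=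
    ⟨w 0, hw.1 0, Submodule.mem_orthogonal_singleton_iff_inner_right.1 (hwe 0)⟩
  have hfe : inner ℂ f e = 0 := inner_eq_zero_symm.1 hef
  have hee : inner ℂ e e = 1 := by simp [inner_self_eq_norm_sq_to_K, he]
  have hff : inner ℂ f f = 1 := by simp [inner_self_eq_norm_sq_to_K, hf]
  set P := rankOneK e e
  -- At `P`, each basic map has value 1 on its own one of these four coefficients and 0 on the other
  -- three, so the scalars can be read off `Ψ`.
  refine ⟨coeff Ψ f e f e P, coeff Ψ e f e f P, coeff Ψ f e e f P, coeff Ψ e f f e P, fun X => ?_⟩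
  have hI := isInvariantForm_one_tensor (H := H)
  have hF := ((((isInvariantForm_coeff he h).add (hI.const_smul (-coeff Ψ f e f e P))).add
    (hI.swap_left.swap_right.const_smul (-coeff Ψ e f e f P))).add
    (hI.swap_right.const_smul (-coeff Ψ f e e f P))).add
    (hI.swap_left.const_smul (-coeff Ψ e f f e P))
  have hz := hF.eq_zero hH he hf hef (by
    constructor <;>
    · simp only [add_apply, smul_apply, entry_rankOneK, hee, hff, hef, hfe, P, smul_eq_mul]
      ring)
  refine ext_tmul fun a b => ext_inner_tmul fun c d => ?_
  have := congrArg (fun T : Compacts H →L[ℂ] ℂ => T X) (hz a b c d)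
  simp only [add_apply, smul_apply, smul_eq_mul, zero_apply, entry_apply, coeff_apply] at this
  simp only [add_apply, smul_apply, mul_apply_eq_comp, opTensor_tmul, swap_tmul,
    one_apply_eq_self, inner_add_right, inner_smul_right, inner_tmul, coeff_apply]
  linear_combination this

end UnitaryCovariance
end

theorem proposition9 {H : Type*} [NormedAddCommGroup H] [InnerProductSpace ℂ H]
    [CompleteSpace H] [TopologicalSpace.SeparableSpace H] (hH : ¬ FiniteDimensional ℂ H)
    (Ψ : Compacts H →L[ℂ] (HilbertTensor H →L[ℂ] HilbertTensor H)) :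
    List.TFAE [
      IsCovariant Ψ,
      ∃ e : H, ‖e‖ = 1 ∧ IsCovariantAt Ψ (rankOneK e e),
      ∃ c₁ c₂ c₃ c₄ : ℂ, ∀ X : Compacts H,
        Ψ X = c₁ • opTensor 1 (X : H →L[ℂ] H) + c₂ • opTensor (X : H →L[ℂ] H) 1
          + c₃ • (swap H * opTensor 1 (X : H →L[ℂ] H))
          + c₄ • (swap H * opTensor (X : H →L[ℂ] H) 1)] := by
  tfae_have 1 → 2 := by
    intro h
    -- With `⊥` the orthogonality is void; only a unit vector is needed.
    obtain ⟨v, hv, -⟩ := exists_orthonormal_orthogonal hH ⊥ 1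
    exact ⟨v 0, hv.1 0, h _⟩
  tfae_have 2 → 3 := fun ⟨_, he, h⟩ => exists_eq_of_isCovariantAt hH he h
  tfae_have 3 → 1 := fun ⟨_, _, _, _, h⟩ => isCovariant_of_eq h
  tfae_finish
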